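/- For a commutative complex Banach algebra $B$, let $\Delta(B)$ be the set of nonzero multiplicative linear functionals on $B$ (these are automatically continuous), and for $a\in B$ let $\widehat a:\Delta(B)\to\mathbb C$, $\widehat a(\varphi)=\varphi(a)$. The algebra $B$ is called semisimple if $\widehat a=0$ implies $a=0$. For $\sigma:\Delta(B)\to\mathbb C$ let $\|\sigma\|_{BSE}$ be the infimum of all $\beta>0$ such that $$\Big|\sum_{k=1}^n\alpha_k\sigma(\varphi_k)\Big|\le\beta\,\Big\|\sum_{k=1}^n\alpha_k\varphi_k\Big\|_{B^*}$$ for all finite families $\alpha_1,\dots,\alpha_n\in\mathbb C$ and $\varphi_1,\dots,\varphi_n\in\Delta(B)$. (For $\sigma=\widehat a$ such $\beta$ exist, and $\|\widehat a\|_{BSE}\le\|a\|$.) The algebra $B$ is called a BSE-norm algebra if there is a constant $K>0$ such that $\|a\|\le K\|\widehat a\|_{BSE}$ for all $a\in B$. For a compact Hausdorff abelian group $G$ with normalized Haar measure $\lambda$, a separable commutative Banach algebra $A$ and $1\le p<\infty$, let $L^p(G,A)$ be the Banach space of (classes modulo almost everywhere equality of) measurable functions $f:G\to A$ with $\|f\|_p=\left(\int_G\|f(x)\|^p\,d\lambda(x)\right)^{1/p}<\infty$.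 It is a commutative Banach algebra under the convolution product $(f*g)(x)=\int_G f(y)\,g(y^{-1}x)\,d\lambda(y)$. Theorem 4.2. Let $A$ be a semisimple, commutative, separable, unital complex Banach algebra, let $G$ be a compact Hausdorff abelian group, and let $1\le p<\infty$. If $L^p(G,A)$ is a BSE-norm algebra, then $A$ is a BSE-norm algebra. Conversely, if $G$ is finite and $A$ is a BSE-norm algebra, then $L^p(G,A)$ is a BSE-norm algebra. -/

import Mathlib

open MeasureTheory Filter Topology
open scoped ENNReal

set_option linter.unusedSectionVars false

/-! ### BSE-norm algebras -/

section BSE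

variable {B : Type*} [NonUnitalNormedCommRing B] [NormedSpace ℂ B]

/-- The Gelfand transform `â : Δ(B) → ℂ`, `â φ = φ a`, of an element of a (not necessarily unital)
commutative Banach algebra. Here `Δ(B)` is `WeakDual.characterSpace ℂ B`, the space of nonzero
multiplicative linear functionals on `B` (on a Banach algebra these are automatically
continuous). -/
noncomputable def gelfandFun (a : B) : WeakDual.characterSpace ℂ B → ℂ := fun φ => φ a

/-- `B` is semisimple: its Gelfand mapping has trivial kernel. -/
def IsGelfandSemisimple (B : Type*) [NonUnitalNormedCommRing B] [NormedSpace ℂ B] : Prop :=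
  ∀ a : B, gelfandFun a = 0 → a = 0

/-- `β > 0` is a BSE-constant for `σ : Δ(B) → ℂ` if
`|∑ αₖ σ(φₖ)| ≤ β ‖∑ αₖ φₖ‖` for all finite families of scalars `αₖ` and characters `φₖ`; the norm
on the right-hand side is the norm of the dual Banach space `B*`. -/
def IsBSEConstant (σ : WeakDual.characterSpace ℂ B → ℂ) (β : ℝ) : Prop :=
  0 < β ∧ ∀ (n : ℕ) (α : Fin n → ℂ) (φ : Fin n → WeakDual.characterSpace ℂ B),
    ‖∑ k, α k * σ (φ k)‖ ≤
      β * ‖∑ k, α k • (WeakDual.toStrongDual (φ k : WeakDual ℂ B) : StrongDual ℂ B)‖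

/-- The BSE-norm of `σ`: the infimum of its BSE-constants. -/
noncomputable def bseNorm (σ : WeakDual.characterSpace ℂ B → ℂ) : ℝ :=
  sInf {β : ℝ | IsBSEConstant σ β}

/-- Every Gelfand transform is a BSE-function, so that the infimum in `bseNorm (gelfandFun a)` is
over a non-empty set: `‖a‖ + ε` is a BSE-constant of `â` for every `ε > 0`. -/
theorem isBSEConstant_gelfandFun (a : B) {ε : ℝ} (hε : 0 < ε) :
    IsBSEConstant (gelfandFun a) (‖a‖ + ε) := by
  refine ⟨by positivity, fun n α φ => ?_⟩
  have h := (∑ k, α k • (WeakDual.toStrongDual (φ k : WeakDual ℂ B) : StrongDual ℂ B)).le_opNorm a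
  rw [sum_apply] at h
  refine le_trans h ?_
  rw [mul_comm]
  gcongr
  linarith

/-- `B` is a BSE-norm algebra: for some constant `K > 0`, `‖a‖ ≤ K ‖â‖_BSE` for all `a`. -/
def IsBSENormAlgebra (B : Type*) [NonUnitalNormedCommRing B] [NormedSpace ℂ B] : Prop :=
  ∃ K : ℝ, 0 < K ∧ ∀ a : B, ‖a‖ ≤ K * bseNorm (gelfandFun a)

end BSE

/-! ### The convolution algebra `L^p(G, A)` of a compact abelian group -/

section Conv

variable {G : Type*} [CommGroup G] [TopologicalSpace G] [IsTopologicalGroup G] [CompactSpace G]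
  [MeasurableSpace G] [BorelSpace G]
variable {A : Type*} [NormedCommRing A] [NormedAlgebra ℂ A]

/-- Convolution of `A`-valued functions: `(f * g)(x) = ∫ f(y) g(y⁻¹ x) dμ(y)`. -/
noncomputable def groupConv (μ : Measure G) (f g : G → A) : G → A :=
  fun x => ∫ y, f y * g (y⁻¹ * x) ∂μ

theorem groupConv_apply (μ : Measure G) (f g : G → A) (x : G) :
    groupConv μ f g x = ∫ y, f y * g (x / y) ∂μ := by
  simp only [groupConv, div_eq_inv_mul]

variable (μ : Measure G) [μ.IsHaarMeasure] [IsProbabilityMeasure μ]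

theorem groupConv_congr {f f' g g' : G → A} (hf : f =ᵐ[μ] f') (hg : g =ᵐ[μ] g') :
    groupConv μ f g = groupConv μ f' g' := by
  funext x
  rw [groupConv_apply, groupConv_apply]
  have h := (Measure.measurePreserving_div_left μ x).quasiMeasurePreserving.ae_eq_comp hg
  refine integral_congr_ae ?_
  filter_upwards [hf, h] with y h1 h2
  simp only [Function.comp] at h2
  rw [h1, h2]

theorem groupConv_comm (f g : G → A) : groupConv μ f g = groupConv μ g f := by
  funext x
  rw [groupConv_apply, groupConv_apply, ← integral_div_left_eq_self _ μ x]
  simp [mul_comm]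

theorem haar_regular : μ.Regular := by
  have hP : IsProbabilityMeasure (Measure.haarMeasure (⊤ : TopologicalSpace.PositiveCompacts G)) :=
    ⟨Measure.haarMeasure_self⟩
  rw [Measure.isHaarMeasure_eq_of_isProbabilityMeasure μ
    (Measure.haarMeasure (⊤ : TopologicalSpace.PositiveCompacts G))]
  infer_instance

/-- Every integrable function on `G` has a representative `g` for which both `g` and
`(x, y) ↦ g (x / y)` are strongly measurable (the latter for the product σ-algebra, although `G`
need not be second countable). -/
theorem exists_good_rep [CompleteSpace A] {g : G → A} (hg : MemLp g 1 μ) :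
    ∃ g' : G → A, g =ᵐ[μ] g' ∧ StronglyMeasurable g' ∧
      StronglyMeasurable fun q : G × G => g' (q.1 / q.2) := by
  have := haar_regular μ
  have H : ∀ n : ℕ, ∃ u : BoundedContinuousFunction G A,
      eLpNorm (g - (u : G → A)) 1 μ ≤ ((n : ℝ≥0∞) + 1)⁻¹ ∧ MemLp u 1 μ := fun n =>
    hg.exists_boundedContinuous_eLpNorm_sub_le (by simp) (by simp)
  choose u hu hu1 using H
  have ht : Tendsto (fun n => eLpNorm ((u n : G → A) - g) 1 μ) atTop (𝓝 0) := by
    have h0 : Tendsto (fun n : ℕ => ((n : ℝ≥0∞) + 1)⁻¹) atTop (𝓝 0) := by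
      have := (tendsto_add_atTop_iff_nat 1).2 ENNReal.tendsto_inv_nat_nhds_zero
      simpa using this
    refine tendsto_of_tendsto_of_tendsto_of_le_of_le tendsto_const_nhds h0 (fun _ => zero_le)
      (fun n => ?_)
    simpa only [eLpNorm_sub_comm] using hu n
  obtain ⟨ns, -, hns⟩ := (tendstoInMeasure_of_tendsto_eLpNorm one_ne_zero
    (fun n => (hu1 n).1) hg.1 ht).exists_seq_tendsto_ae
  refine ⟨fun z => limUnder atTop fun i => u (ns i) z, ?_, ?_, ?_⟩
  · filter_upwards [hns] with x hx
    exact hx.limUnder_eq.symm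
  · refine StronglyMeasurable.limUnder fun i => ?_
    exact (u (ns i)).continuous.stronglyMeasurable_of_hasCompactSupport
      (HasCompactSupport.of_compactSpace _)
  · refine StronglyMeasurable.limUnder fun i => ?_
    exact HasCompactSupport.stronglyMeasurable_of_prod (by fun_prop)
      (HasCompactSupport.of_compactSpace _)

theorem groupConv_aux [CompleteSpace A] {p : ℝ≥0∞} (hp1 : 1 ≤ p) (hp : p ≠ ∞)
    {f g : G → A} (hf : MemLp f p μ) (hg : MemLp g p μ) :
    AEStronglyMeasurable (groupConv μ f g) μ ∧
    eLpNorm (groupConv μ f g) p μ ≤ eLpNorm f p μ * eLpNorm g p μ ∧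
    ∀ᵐ x ∂μ, Integrable (fun y => f y * g (x / y)) μ := by
  obtain ⟨f', hff', hf', -⟩ := exists_good_rep μ (hf.mono_exponent hp1)
  obtain ⟨g', hgg', hg', hg''⟩ := exists_good_rep μ (hg.mono_exponent hp1)
  have hi : ∀ x, (fun y => f y * g (x / y)) =ᵐ[μ] fun y => f' y * g' (x / y) := by
    intro x
    have h := (Measure.measurePreserving_div_left μ x).quasiMeasurePreserving.ae_eq_comp hgg'
    filter_upwards [hff', h] with y h1 h2
    simp only [Function.comp] at h2
    rw [h1, h2]
  rw [groupConv_congr μ hff' hgg', eLpNorm_congr_ae hff', eLpNorm_congr_ae hgg']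
  have hf1 := (memLp_congr_ae hff').1 hf
  have hg1 := (memLp_congr_ae hgg').1 hg
  simp only [fun x => integrable_congr (hi x)]
  clear hi hff' hgg' hf hg f g
  have hF : StronglyMeasurable fun q : G × G => f' q.2 * g' (q.1 / q.2) :=
    (hf'.comp_measurable measurable_snd).mul hg''
  have hFx : ∀ x, StronglyMeasurable fun y => f' y * g' (x / y) := fun x =>
    hF.comp_measurable measurable_prodMk_left
  have hp0 : p ≠ 0 := (zero_lt_one.trans_le hp1).ne'
  have hr : 0 < p.toReal := ENNReal.toReal_pos hp0 hp
  have hmeas : StronglyMeasurable (groupConv μ f' g') := by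
    have : groupConv μ f' g' = fun x => ∫ y, f' y * g' (x / y) ∂μ :=
      funext (groupConv_apply μ f' g')
    rw [this]
    exact hF.integral_prod_right
  have key : ∫⁻ x, (∫⁻ y, ‖f' y * g' (x / y)‖ₑ ∂μ) ^ p.toReal ∂μ ≤
      (eLpNorm f' p μ * eLpNorm g' p μ) ^ p.toReal := by
    have e : ∀ {h : G → A}, eLpNorm h p μ ^ p.toReal = ∫⁻ y, ‖h y‖ₑ ^ p.toReal ∂μ := by
      intro h
      rw [eLpNorm_eq_lintegral_rpow_enorm_toReal hp0 hp, ← ENNReal.rpow_mul, one_div,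
        inv_mul_cancel₀ hr.ne', ENNReal.rpow_one]
    calc ∫⁻ x, (∫⁻ y, ‖f' y * g' (x / y)‖ₑ ∂μ) ^ p.toReal ∂μ
        ≤ ∫⁻ x, ∫⁻ y, ‖f' y‖ₑ ^ p.toReal * ‖g' (x / y)‖ₑ ^ p.toReal ∂μ ∂μ := by
          refine lintegral_mono fun x => ?_
          rw [← eLpNorm_one_eq_lintegral_enorm]
          refine (ENNReal.rpow_le_rpow (eLpNorm_le_eLpNorm_of_exponent_le hp1
            (hFx x).aestronglyMeasurable) hr.le).trans ?_
          rw [e]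
          refine lintegral_mono fun y => ?_
          rw [← ENNReal.mul_rpow_of_nonneg _ _ hr.le]
          gcongr
          simpa only [enorm, ← ENNReal.coe_mul, ENNReal.coe_le_coe] using nnnorm_mul_le _ _
      _ = ∫⁻ y, ∫⁻ x, ‖f' y‖ₑ ^ p.toReal * ‖g' (x / y)‖ₑ ^ p.toReal ∂μ ∂μ := by
          refine lintegral_lintegral_swap (Measurable.aemeasurable ?_)
          exact ((hf'.comp_measurable measurable_snd).enorm.pow_const _).mul
            (hg''.enorm.pow_const _)
      _ = ∫⁻ y, ‖f' y‖ₑ ^ p.toReal * eLpNorm g' p μ ^ p.toReal ∂μ := by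
          refine lintegral_congr fun y => ?_
          rw [lintegral_const_mul', lintegral_div_right_eq_self (fun x => ‖g' x‖ₑ ^ p.toReal), e]
          exact (ENNReal.rpow_lt_top_of_nonneg hr.le enorm_ne_top).ne
      _ = (eLpNorm f' p μ * eLpNorm g' p μ) ^ p.toReal := by
          rw [lintegral_mul_const, ← e, ENNReal.mul_rpow_of_nonneg _ _ hr.le]
          exact hf'.enorm.pow_const _
  refine ⟨hmeas.aestronglyMeasurable, ?_, ?_⟩
  · rw [← ENNReal.rpow_le_rpow_iff hr]
    refine le_trans ?_ key
    rw [eLpNorm_eq_lintegral_rpow_enorm_toReal hp0 hp, ← ENNReal.rpow_mul, one_div,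
        inv_mul_cancel₀ hr.ne', ENNReal.rpow_one]
    refine lintegral_mono fun x => ?_
    rw [groupConv_apply]
    gcongr
    exact enorm_integral_le_lintegral_enorm _
  · have hfin : ∫⁻ x, (∫⁻ y, ‖f' y * g' (x / y)‖ₑ ∂μ) ^ p.toReal ∂μ ≠ ∞ :=
      ne_top_of_le_ne_top (ENNReal.rpow_lt_top_of_nonneg hr.le
        (ENNReal.mul_ne_top hf1.2.ne hg1.2.ne)).ne key
    have hm : Measurable fun x => (∫⁻ y, ‖f' y * g' (x / y)‖ₑ ∂μ) ^ p.toReal :=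
      (hF.enorm.lintegral_prod_right').pow_const _
    filter_upwards [ae_lt_top hm hfin] with x hx
    refine ⟨(hFx x).aestronglyMeasurable, ?_⟩
    exact (ENNReal.rpow_lt_top_iff_of_pos hr).1 hx

theorem groupConv_memLp [CompleteSpace A] {p : ℝ≥0∞} (hp1 : 1 ≤ p) (hp : p ≠ ∞)
    {f g : G → A} (hf : MemLp f p μ) (hg : MemLp g p μ) : MemLp (groupConv μ f g) p μ :=
  ⟨(groupConv_aux μ hp1 hp hf hg).1, (groupConv_aux μ hp1 hp hf hg).2.1.trans_lt
    (ENNReal.mul_lt_top hf.2 hg.2)⟩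

theorem groupConv_assoc {f g h : G → A} [CompleteSpace A] (hf : Continuous f) (hg : Continuous g)
    (hh : Continuous h) :
    groupConv μ (groupConv μ f g) h = groupConv μ f (groupConv μ g h) := by
  have hint : ∀ {u : G → A}, Continuous u → Integrable u μ := fun hu =>
    hu.integrable_of_hasCompactSupport (HasCompactSupport.of_compactSpace _)
  funext x
  calc groupConv μ (groupConv μ f g) h x
      = ∫ y, ∫ z, f z * g (y / z) * h (x / y) ∂μ ∂μ := by
        rw [groupConv_apply]
        congr 1 with y
        rw [groupConv_apply, integral_mul_const_of_integrable]
        exact hint (by fun_prop)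
    _ = ∫ z, ∫ y, f z * g (y / z) * h (x / y) ∂μ ∂μ :=
        integral_integral_swap_of_hasCompactSupport (by unfold Function.uncurry; fun_prop)
          (HasCompactSupport.of_compactSpace _)
    _ = ∫ z, ∫ y, f z * (g y * h (x / z / y)) ∂μ ∂μ := by
        congr 1 with z
        rw [← integral_mul_right_eq_self _ z]
        congr 1 with y
        rw [mul_div_cancel_right, mul_assoc, div_div, mul_comm y z]
    _ = groupConv μ f (groupConv μ g h) x := by
        rw [groupConv_apply]
        congr 1 with z
        rw [groupConv_apply, integral_const_mul_of_integrable]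
        exact hint (by fun_prop)

/-- The Banach space `L^p(G, A)` (classes modulo a.e. equality of `p`-integrable strongly
measurable functions), regarded as a Banach algebra under convolution. -/
def LpConv (A : Type*) [NormedCommRing A] (p : ℝ≥0∞) (μ : Measure G) : Type _ :=
  Lp A p μ

namespace LpConv

variable {p : ℝ≥0∞} [h1 : Fact (1 ≤ p)] [htop : Fact (p ≠ ∞)]

noncomputable instance : NormedAddCommGroup (LpConv A p μ) :=
  inferInstanceAs (NormedAddCommGroup (Lp A p μ))

noncomputable instance : NormedSpace ℂ (LpConv A p μ) :=
  inferInstanceAs (NormedSpace ℂ (Lp A p μ))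

instance [CompleteSpace A] : CompleteSpace (LpConv A p μ) :=
  inferInstanceAs (CompleteSpace (Lp A p μ))

/-- The underlying function class of an element of `LpConv A p μ`. -/
def toLp (f : LpConv A p μ) : Lp A p μ := f

variable [CompleteSpace A]

/-- The product of `L^p(G, A)` is convolution. -/
noncomputable instance : Mul (LpConv A p μ) :=
  ⟨fun f g => (groupConv_memLp μ h1.out htop.out (Lp.memLp (toLp μ f)) (Lp.memLp (toLp μ g))).toLp
    (groupConv μ (toLp μ f) (toLp μ g))⟩

theorem coeFn_mul (f g : LpConv A p μ) :
    toLp μ (f * g) =ᵐ[μ] groupConv μ (toLp μ f) (toLp μ g) :=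
  MemLp.coeFn_toLp
    (groupConv_memLp μ h1.out htop.out (Lp.memLp (toLp μ f)) (Lp.memLp (toLp μ g)))

theorem norm_mul_le' (f g : LpConv A p μ) : ‖f * g‖ ≤ ‖f‖ * ‖g‖ := by
  change ‖toLp μ (f * g)‖ ≤ ‖toLp μ f‖ * ‖toLp μ g‖
  have hf := Lp.memLp (toLp μ f)
  have hg := Lp.memLp (toLp μ g)
  rw [Lp.norm_def, Lp.norm_def, Lp.norm_def, ← ENNReal.toReal_mul,
    eLpNorm_congr_ae (coeFn_mul μ f g)]
  exact ENNReal.toReal_mono (ENNReal.mul_ne_top hf.2.ne hg.2.ne)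
    (groupConv_aux μ h1.out htop.out hf hg).2.1

theorem mul_comm' (f g : LpConv A p μ) : f * g = g * f := by
  refine Lp.ext (μ := μ) ((coeFn_mul μ f g).trans ?_)
  rw [groupConv_comm]
  exact (coeFn_mul μ g f).symm

theorem mul_add' (f g h : LpConv A p μ) : f * (g + h) = f * g + f * h := by
  refine Lp.ext (μ := μ) ((coeFn_mul μ f (g + h)).trans ?_)
  refine EventuallyEq.trans ?_ (Lp.coeFn_add (toLp μ (f * g)) (toLp μ (f * h))).symm
  have e : groupConv μ (toLp μ f) (toLp μ (g + h)) =
      groupConv μ (toLp μ f) (⇑(toLp μ g) + ⇑(toLp μ h)) :=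
    groupConv_congr μ (EventuallyEq.refl _ _) (Lp.coeFn_add (toLp μ g) (toLp μ h))
  rw [e]
  filter_upwards [coeFn_mul μ f g, coeFn_mul μ f h,
    (groupConv_aux μ h1.out htop.out (Lp.memLp (toLp μ f)) (Lp.memLp (toLp μ g))).2.2,
    (groupConv_aux μ h1.out htop.out (Lp.memLp (toLp μ f)) (Lp.memLp (toLp μ h))).2.2]
    with x hx1 hx2 hx3 hx4
  rw [Pi.add_apply, hx1, hx2, groupConv_apply, groupConv_apply, groupConv_apply,
    ← integral_add hx3 hx4]
  simp only [Pi.add_apply, mul_add]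

theorem mul_smul' (c : ℂ) (f g : LpConv A p μ) : f * (c • g) = c • (f * g) := by
  refine Lp.ext (μ := μ) ((coeFn_mul μ f (c • g)).trans ?_)
  refine EventuallyEq.trans ?_ (Lp.coeFn_smul c (toLp μ (f * g))).symm
  have e : groupConv μ (toLp μ f) (toLp μ (c • g)) =
      groupConv μ (toLp μ f) (c • ⇑(toLp μ g)) :=
    groupConv_congr μ (EventuallyEq.refl _ _) (Lp.coeFn_smul c (toLp μ g))
  rw [e]
  filter_upwards [coeFn_mul μ f g] with x hx
  rw [Pi.smul_apply, hx, groupConv_apply, groupConv_apply, ← integral_smul]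
  simp only [Pi.smul_apply, mul_smul_comm]

/-- Convolution as a bounded bilinear map. -/
noncomputable def mulCLM : LpConv A p μ →L[ℂ] LpConv A p μ →L[ℂ] LpConv A p μ :=
  LinearMap.mkContinuous₂
    (LinearMap.mk₂ ℂ (fun f g : LpConv A p μ => f * g)
      (fun f g h => by rw [mul_comm' μ _ h, mul_add', mul_comm' μ h, mul_comm' μ h])
      (fun c f g => by rw [mul_comm' μ _ g, mul_smul', mul_comm' μ g])
      (mul_add' μ) (fun c f g => mul_smul' μ c f g))
    1 (fun f g => by simpa using norm_mul_le' μ f g)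

theorem continuous_mul' :
    Continuous fun q : LpConv A p μ × LpConv A p μ => q.1 * q.2 :=
  (mulCLM μ (A := A) (p := p)).continuous₂

theorem dense_continuous :
    Dense {f : LpConv A p μ | ∃ u : G → A, Continuous u ∧ toLp μ f =ᵐ[μ] u} := by
  have := haar_regular μ
  refine Metric.dense_iff.2 fun f r hr => ?_
  obtain ⟨u, hu, hu'⟩ := (Lp.memLp (toLp μ f)).exists_boundedContinuous_eLpNorm_sub_le htop.out
    (ε := ENNReal.ofReal (r / 2)) (by simpa using hr)
  refine ⟨hu'.toLp u, ?_, u, u.continuous, hu'.coeFn_toLp⟩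
  change dist (hu'.toLp u) (toLp μ f) < r
  rw [dist_comm, Lp.dist_def]
  have e : eLpNorm (⇑(toLp μ f) - ⇑(hu'.toLp u)) p μ ≤ ENNReal.ofReal (r / 2) := by
    rwa [eLpNorm_congr_ae ((EventuallyEq.refl _ _).sub hu'.coeFn_toLp)]
  refine (ENNReal.toReal_mono ENNReal.ofReal_ne_top e).trans_lt ?_
  rw [ENNReal.toReal_ofReal (by positivity)]
  linarith

theorem mul_assoc' (f g h : LpConv A p μ) : f * g * h = f * (g * h) := by
  have hm := continuous_mul' (A := A) (p := p) μ
  have hc1 : Continuous fun q : LpConv A p μ × LpConv A p μ × LpConv A p μ =>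
      q.1 * q.2.1 * q.2.2 :=
    hm.comp ((hm.comp (continuous_fst.prodMk (continuous_fst.comp continuous_snd))).prodMk
      (continuous_snd.comp continuous_snd))
  have hc2 : Continuous fun q : LpConv A p μ × LpConv A p μ × LpConv A p μ =>
      q.1 * (q.2.1 * q.2.2) :=
    hm.comp (continuous_fst.prodMk (hm.comp continuous_snd))
  have hd := dense_continuous (A := A) (p := p) μ
  refine congrFun (hc1.ext_on (hd.prod (hd.prod hd)) hc2 ?_) (f, g, h)
  rintro ⟨f, g, h⟩ ⟨⟨u, hu, hu'⟩, ⟨v, hv, hv'⟩, ⟨w, hw, hw'⟩⟩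
  have e1 : ⇑(toLp μ (f * g)) =ᵐ[μ] groupConv μ u v :=
    (coeFn_mul μ f g).trans (EventuallyEq.of_eq (groupConv_congr μ hu' hv'))
  have e2 : ⇑(toLp μ (g * h)) =ᵐ[μ] groupConv μ v w :=
    (coeFn_mul μ g h).trans (EventuallyEq.of_eq (groupConv_congr μ hv' hw'))
  refine Lp.ext (μ := μ) ((coeFn_mul μ (f * g) h).trans
    (EventuallyEq.trans ?_ (coeFn_mul μ f (g * h)).symm))
  rw [groupConv_congr μ e1 hw', groupConv_congr μ hu' e2, groupConv_assoc μ hu hv hw]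

/-- `L^p(G, A)` is a commutative Banach algebra under convolution. -/
noncomputable instance : NonUnitalNormedCommRing (LpConv A p μ) where
  left_distrib := mul_add' μ
  right_distrib f g h := by rw [mul_comm' μ _ h, mul_add', mul_comm' μ h, mul_comm' μ h]
  zero_mul f := by
    have h := (mulCLM μ (A := A) (p := p)).map_zero₂ f
    exact h
  mul_zero f := (mulCLM μ f).map_zero
  mul_assoc := mul_assoc' μ
  mul_comm := mul_comm' μ
  norm_mul_le := norm_mul_le' μ
  dist_eq := dist_eq_norm_neg_add

instance : SMulCommClass ℂ (LpConv A p μ) (LpConv A p μ) :=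
  ⟨fun c f g => (mul_smul' μ c f g).symm⟩

instance : IsScalarTower ℂ (LpConv A p μ) (LpConv A p μ) :=
  ⟨fun c f g => by
    simp only [smul_eq_mul]
    rw [mul_comm, mul_smul', mul_comm]⟩

end LpConv

end Conv

/-! ### BSE-norms and isometric homomorphisms. -/

section BSE

variable {B : Type*} [NonUnitalNormedCommRing B] [NormedSpace ℂ B]

/-! Necessity: since the Haar measure has mass one, `a ↦` (constant function `a`) is an isometric
homomorphism `ι : A → L^p(G, A)`. Under such an `ι`, a character of the larger algebra pulls back to
a character or to `0`, and pulling back does not increase dual norms. Hence `‖ι a‖_BSE ≤ ‖a‖_BSE`,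
and a BSE-norm inequality passes down with the same `K` (`IsBSENormAlgebra.of_isometric`).

Sufficiency, `G` finite: a character `φ` of `A` and a character `ψ` of `G` combine into a character
`φ ⊗ ψ` of `L^p(G, A)`, the `ψ`-th Fourier coefficient of `φ ∘ f`. Fourier inversion gives `φ(f(x))
= ∑_ψ ψ(x) (φ ⊗ ψ)(f)`, so a combination of characters of `A` evaluated at `f(x)` is a combination
of characters of `L^p(G, A)` evaluated at `f`. Evaluation at `x` has norm at most `|G|`, whence
`‖f(x)‖_BSE ≤ |G| ‖f‖_BSE` (`isBSEConstant_apply`). Finally `‖f‖_p ≤ max_x ‖f(x)‖`. No complete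
description of the characters of `L^p(G, A)` is needed. -/

theorem bseNorm_le {σ : WeakDual.characterSpace ℂ B → ℂ} {β : ℝ} (h : IsBSEConstant σ β) :
    bseNorm σ ≤ β :=
  csInf_le ⟨0, fun _ hb => hb.1.le⟩ h

/-- Restricted to Gelfand transforms because their set of BSE-constants is nonempty; the real
infimum of the empty set would be `0`. -/
theorem le_bseNorm_gelfandFun {a : B} {r : ℝ}
    (h : ∀ β, IsBSEConstant (gelfandFun a) β → r ≤ β) : r ≤ bseNorm (gelfandFun a) :=
  le_csInf ⟨_, isBSEConstant_gelfandFun a one_pos⟩ h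

theorem gelfandFun_apply (a : B) (φ : WeakDual.characterSpace ℂ B) : gelfandFun a φ = φ a := rfl

/-- A BSE-constant may be tested against families indexed by any finite type. -/
theorem IsBSEConstant.norm_sum_le {σ : WeakDual.characterSpace ℂ B → ℂ} {β : ℝ}
    (h : IsBSEConstant σ β) {ι : Type*} [Fintype ι] (α : ι → ℂ)
    (φ : ι → WeakDual.characterSpace ℂ B) :
    ‖∑ k, α k * σ (φ k)‖ ≤
      β * ‖∑ k, α k • (WeakDual.toStrongDual (φ k : WeakDual ℂ B) : StrongDual ℂ B)‖ := by
  let e := (Fintype.equivFin ι).symm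
  have := h.2 _ (α ∘ e) (φ ∘ e)
  simp only [Function.comp] at this
  rwa [e.sum_comp fun k => α k * σ (φ k), e.sum_comp fun k =>
    α k • (WeakDual.toStrongDual (φ k : WeakDual ℂ B) : StrongDual ℂ B)] at this

theorem norm_sum_smul_character_le {ι : Type*} [Fintype ι] (α : ι → ℂ)
    (φ : ι → WeakDual.characterSpace ℂ B) {M : ℝ} (hM : 0 ≤ M)
    (h : ∀ b, ‖∑ k, α k * φ k b‖ ≤ M * ‖b‖) :
    ‖∑ k, α k • (WeakDual.toStrongDual (φ k : WeakDual ℂ B) : StrongDual ℂ B)‖ ≤ M := by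
  refine ContinuousLinearMap.opNorm_le_bound _ hM fun b => ?_
  rw [sum_apply]
  exact h b

theorem norm_sum_mul_character_le {ι : Type*} [Fintype ι] (α : ι → ℂ)
    (φ : ι → WeakDual.characterSpace ℂ B) (b : B) :
    ‖∑ k, α k * φ k b‖ ≤
      ‖∑ k, α k • (WeakDual.toStrongDual (φ k : WeakDual ℂ B) : StrongDual ℂ B)‖ * ‖b‖ := by
  have h := (∑ k, α k • (WeakDual.toStrongDual (φ k : WeakDual ℂ B) : StrongDual ℂ B)).le_opNorm b
  rw [sum_apply] at h
  exact h

variable {C : Type*} [NonUnitalNormedCommRing C] [NormedSpace ℂ C]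

/-- BSE-constants pull back along isometric homomorphisms `ι : C → B`: a BSE-constant of the
Gelfand transform of `a` is one of the Gelfand transform of `ι a`. -/
theorem IsBSEConstant.map_isometric (ι : C →L[ℂ] B) (hmul : ∀ a b, ι (a * b) = ι a * ι b)
    (hι : ∀ a, ‖ι a‖ = ‖a‖) {a : C} {β : ℝ} (h : IsBSEConstant (gelfandFun a) β) :
    IsBSEConstant (gelfandFun (ι a)) β := by
  classical
  refine ⟨h.1, fun n α Φ => ?_⟩
  -- The zero functional is not a character, so the indices with `Φ k ∘ ι = 0` are discarded; they
  -- contribute nothing to the sums.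
  let S : Type := {k : Fin n // ∃ b, Φ k (ι b) ≠ 0}
  let φ : S → WeakDual.characterSpace ℂ C := fun k =>
    ⟨((WeakDual.toStrongDual (Φ k.1 : WeakDual ℂ B)).comp ι : StrongDual ℂ C), by
      constructor
      · intro h0
        obtain ⟨b, hb⟩ := k.2
        exact hb (DFunLike.congr_fun h0 b)
      · intro x y
        change Φ k.1 (ι (x * y)) = Φ k.1 (ι x) * Φ k.1 (ι y)
        rw [hmul, map_mul]⟩
  have hφ : ∀ (k : S) b, φ k b = Φ k.1 (ι b) := fun _ _ => rfl
  have key : ∀ b, ∑ k, α k * Φ k (ι b) = ∑ k : S, α k.1 * φ k b := by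
    intro b
    simp only [hφ]
    rw [← Finset.sum_subtype {k : Fin n | ∃ b, Φ k (ι b) ≠ 0} (by simp)
      fun k => α k * Φ k (ι b)]
    refine (Finset.sum_filter_of_ne fun k _ hk => ⟨b, ?_⟩).symm
    exact right_ne_zero_of_mul hk
  simp only [gelfandFun_apply, key]
  refine (h.norm_sum_le (fun k : S => α k.1) φ).trans ?_
  refine mul_le_mul_of_nonneg_left ?_ h.1.le
  refine norm_sum_smul_character_le _ _ (norm_nonneg _) fun b => ?_
  rw [← key, ← hι b]
  exact norm_sum_mul_character_le α Φ (ι b)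

theorem IsBSENormAlgebra.of_isometric (ι : C →L[ℂ] B) (hmul : ∀ a b, ι (a * b) = ι a * ι b)
    (hι : ∀ a, ‖ι a‖ = ‖a‖) (h : IsBSENormAlgebra B) : IsBSENormAlgebra C := by
  obtain ⟨K, hK, h⟩ := h
  refine ⟨K, hK, fun a => ?_⟩
  rw [← hι a]
  refine (h (ι a)).trans (mul_le_mul_of_nonneg_left ?_ hK.le)
  exact le_bseNorm_gelfandFun fun β hβ => bseNorm_le (hβ.map_isometric ι hmul hι)

end BSE

/-! ### Constant functions in the convolution algebra. -/

namespace LpConv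

variable {G : Type*} [CommGroup G] [TopologicalSpace G] [IsTopologicalGroup G] [CompactSpace G]
  [MeasurableSpace G] [BorelSpace G]
  {A : Type*} [NormedCommRing A] [NormedAlgebra ℂ A]
  (μ : Measure G) [μ.IsHaarMeasure] [IsProbabilityMeasure μ]
  (p : ℝ≥0∞) [h1 : Fact (1 ≤ p)] [htop : Fact (p ≠ ∞)]

/-- The element of `L^p(G, A)` given by a constant function. -/
noncomputable def constFun (a : A) : LpConv A p μ := (memLp_const a : MemLp _ p μ).toLp fun _ => a

theorem coeFn_constFun (a : A) : toLp μ (constFun μ p a) =ᵐ[μ] fun _ => a :=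
  MemLp.coeFn_toLp (memLp_const a)

theorem norm_constFun (a : A) : ‖constFun μ p a‖ = ‖a‖ := by
  change ‖(memLp_const a : MemLp _ p μ).toLp fun _ => a‖ = ‖a‖
  rw [Lp.norm_toLp, eLpNorm_const' a (zero_lt_one.trans_le h1.out).ne' htop.out]
  simp

/-- The embedding of `A` into `L^p(G, A)` as the constant functions. -/
noncomputable def constCLM : A →L[ℂ] LpConv A p μ :=
  LinearMap.mkContinuous
    { toFun := constFun μ p
      map_add' := fun _ _ => rfl
      map_smul' := fun _ _ => rfl } 1 fun a => by
        rw [one_mul]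
        exact (norm_constFun μ p a).le

theorem constFun_mul [CompleteSpace A] (a b : A) :
    constFun μ p (a * b) = constFun μ p a * constFun μ p b := by
  refine Lp.ext (μ := μ) ((coeFn_constFun μ p (a * b)).trans
    (EventuallyEq.trans ?_ (coeFn_mul μ _ _).symm))
  rw [groupConv_congr μ (coeFn_constFun μ p a) (coeFn_constFun μ p b)]
  refine EventuallyEq.of_eq (funext fun x => ?_)
  simp [groupConv]

/-! ### Finite groups: point evaluations and Fourier inversion. -/

section Finite

variable [T2Space G] [Finite G]

theorem real_singleton (x : G) : μ.real {x} = (Nat.card G : ℝ)⁻¹ := by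
  have := Fintype.ofFinite G
  have h : ∀ y, μ.real {y} = μ.real {x} := fun y => by
    simp only [measureReal_def, Measure.haar_singleton]
  have hs : ∑ y : G, μ.real {y} = 1 := by
    rw [sum_measureReal_singleton]
    simp
  simp only [h, Finset.sum_const, Finset.card_univ, nsmul_eq_mul] at hs
  rw [Nat.card_eq_fintype_card]
  exact eq_inv_of_mul_eq_one_right hs

/-- Every point has positive mass, so null sets are empty and classes are genuine functions. -/
theorem eq_of_ae_eq {E : Type*} {f g : G → E} (h : f =ᵐ[μ] g) : f = g := by
  funext x
  by_contra hx
  have h0 : μ {x} = 0 := measure_mono_null (by simpa using hx) (mem_ae_iff.1 h)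
  have := real_singleton μ x
  rw [measureReal_def, h0] at this
  have hc : (Nat.card G : ℝ) ≠ 0 := by exact_mod_cast Nat.card_pos.ne'
  exact inv_ne_zero hc this.symm

theorem mul_apply [Fintype G] [CompleteSpace A] (f g : LpConv A p μ) (x : G) :
    toLp μ (f * g) x =
      (Nat.card G : ℝ)⁻¹ • ∑ y, toLp μ f y * toLp μ g (x / y) := by
  rw [eq_of_ae_eq μ (coeFn_mul μ f g), groupConv_apply, integral_fintype .of_finite]
  simp only [real_singleton, Finset.smul_sum]

/-- `‖f(x)‖ / |G|` is one term of the `L^1` norm, which is at most the `L^p` norm on a probability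
space. The constant is not sharp, but it is independent of `p`. -/
theorem norm_apply_le (f : LpConv A p μ) (x : G) : ‖toLp μ f x‖ ≤ Nat.card G * ‖f‖ := by
  have := Fintype.ofFinite G
  have hc : (0 : ℝ) < Nat.card G := by exact_mod_cast Nat.card_pos
  rw [← inv_mul_le_iff₀ hc]
  calc (Nat.card G : ℝ)⁻¹ * ‖toLp μ f x‖
      ≤ ∑ y, (Nat.card G : ℝ)⁻¹ * ‖toLp μ f y‖ :=
        Finset.single_le_sum (f := fun y => (Nat.card G : ℝ)⁻¹ * ‖toLp μ f y‖)
          (fun y _ => by positivity) (Finset.mem_univ x)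
    _ = ∫ y, ‖toLp μ f y‖ ∂μ := by
        rw [integral_fintype .of_finite]
        simp only [real_singleton, smul_eq_mul]
    _ = (eLpNorm (toLp μ f) 1 μ).toReal := by
        rw [integral_norm_eq_lintegral_enorm (Lp.aestronglyMeasurable _),
          eLpNorm_one_eq_lintegral_enorm]
    _ ≤ ‖f‖ := ENNReal.toReal_mono (Lp.memLp (toLp μ f)).2.ne
        (eLpNorm_le_eLpNorm_of_exponent_le h1.out (Lp.aestronglyMeasurable _))

theorem norm_le_of_forall_norm_apply_le (f : LpConv A p μ) {M : ℝ} (hM : 0 ≤ M)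
    (h : ∀ x, ‖toLp μ f x‖ ≤ M) : ‖f‖ ≤ M := by
  have := Lp.norm_le_of_ae_bound (f := toLp μ f) hM (.of_forall h)
  simp only [measureUnivNNReal, measure_univ, ENNReal.toNNReal_one, NNReal.coe_one,
    Real.one_rpow, one_mul] at this
  exact this

/-- Evaluation at a point of a finite group, as a bounded operator. -/
noncomputable def evalCLM (x : G) : LpConv A p μ →L[ℂ] A :=
  LinearMap.mkContinuous
    { toFun := fun f => toLp μ f x
      map_add' := fun f g =>
        congrFun (eq_of_ae_eq μ (Lp.coeFn_add (toLp μ f) (toLp μ g))) x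
      map_smul' := fun c f =>
        congrFun (eq_of_ae_eq μ (Lp.coeFn_smul c (toLp μ f))) x } (Nat.card G)
    fun f => norm_apply_le μ p f x

variable [Fintype G]

/-- The functional `f ↦ ∫ ψ(y⁻¹) φ(f(y)) dμ(y)` on `L^p(G, A)`. -/
noncomputable def fourierCLM (φ : WeakDual.characterSpace ℂ A) (ψ : AddChar (Additive G) ℂ) :
    StrongDual ℂ (LpConv A p μ) :=
  (Nat.card G : ℂ)⁻¹ • ∑ y, ψ (.ofMul y⁻¹) •
    (WeakDual.toStrongDual (φ : WeakDual ℂ A)).comp (evalCLM μ p y)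

theorem fourierCLM_apply (φ : WeakDual.characterSpace ℂ A) (ψ : AddChar (Additive G) ℂ)
    (f : LpConv A p μ) :
    fourierCLM μ p φ ψ f =
      (Nat.card G : ℂ)⁻¹ * ∑ y, ψ (.ofMul y⁻¹) * φ (toLp μ f y) := by
  rw [fourierCLM, smul_apply, sum_apply]
  rfl

theorem fourierCLM_mul [CompleteSpace A] (φ : WeakDual.characterSpace ℂ A)
    (ψ : AddChar (Additive G) ℂ) (f g : LpConv A p μ) :
    fourierCLM μ p φ ψ (f * g) = fourierCLM μ p φ ψ f * fourierCLM μ p φ ψ g := by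
  have hψ : ∀ y z : G, ψ (.ofMul (z * y)⁻¹) = ψ (.ofMul y⁻¹) * ψ (.ofMul z⁻¹) := fun y z => by
    rw [← AddChar.map_add_eq_mul, ← ofMul_mul, mul_inv_rev]
  have hφ : ∀ x, φ (toLp μ (f * g) x) =
      (Nat.card G : ℂ)⁻¹ * ∑ y, φ (toLp μ f y) * φ (toLp μ g (x / y)) := fun x => by
    -- The real scalar is made complex so that the `ℂ`-linear `φ` commutes with it.
    rw [mul_apply, ← Complex.coe_smul, map_smul, map_sum]
    simp
  simp only [fourierCLM_apply, hφ]
  calc (Nat.card G : ℂ)⁻¹ * ∑ x, ψ (.ofMul x⁻¹) *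
        ((Nat.card G : ℂ)⁻¹ * ∑ y, φ (toLp μ f y) * φ (toLp μ g (x / y)))
      = (Nat.card G : ℂ)⁻¹ * ((Nat.card G : ℂ)⁻¹ *
        ∑ y, ∑ x, ψ (.ofMul x⁻¹) * (φ (toLp μ f y) * φ (toLp μ g (x / y)))) := by
        rw [Finset.sum_comm]
        simp only [Finset.mul_sum]
        congr! 3
        ring
    _ = (Nat.card G : ℂ)⁻¹ * ((Nat.card G : ℂ)⁻¹ *
        ∑ y, ∑ z, (ψ (.ofMul y⁻¹) * φ (toLp μ f y)) * (ψ (.ofMul z⁻¹) * φ (toLp μ g z))) := by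
        congr! 3 with y
        -- Substituting `x = z * y` splits `ψ(x⁻¹)` and turns `x / y` into `z`.
        rw [← Equiv.sum_comp (Equiv.mulRight y)]
        refine Finset.sum_congr rfl fun z _ => ?_
        rw [Equiv.coe_mulRight, hψ, mul_div_cancel_right]
        ring
    _ = _ := by
        rw [← Finset.sum_mul_sum]
        ring

/-- Fourier inversion on a finite abelian group. -/
theorem sum_fourierCLM (φ : WeakDual.characterSpace ℂ A) (f : LpConv A p μ) (x : G) :
    ∑ ψ : AddChar (Additive G) ℂ, ψ (.ofMul x) * fourierCLM μ p φ ψ f = φ (toLp μ f x) := by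
  classical
  have hc : (Nat.card G : ℂ) ≠ 0 := by exact_mod_cast Nat.card_pos.ne'
  simp only [fourierCLM_apply]
  calc ∑ ψ : AddChar (Additive G) ℂ,
        ψ (.ofMul x) * ((Nat.card G : ℂ)⁻¹ * ∑ y, ψ (.ofMul y⁻¹) * φ (toLp μ f y))
      = (Nat.card G : ℂ)⁻¹ * ∑ y, (∑ ψ : AddChar (Additive G) ℂ, ψ (.ofMul (x * y⁻¹))) *
          φ (toLp μ f y) := by
        simp only [ofMul_mul, AddChar.map_add_eq_mul, Finset.mul_sum, Finset.sum_mul]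
        rw [Finset.sum_comm]
        congr! 2
        ring
    _ = (Nat.card G : ℂ)⁻¹ * ∑ y, (if y = x then (Nat.card G : ℂ) else 0) *
          φ (toLp μ f y) := by
        congr! 3 with y
        have hy : Additive.ofMul (x * y⁻¹) = 0 ↔ y = x :=
          ofMul_eq_zero.trans (mul_inv_eq_one.trans eq_comm)
        -- Orthogonality: the sum over the dual group is `|G|` at the identity and `0` elsewhere.
        simp only [AddChar.sum_apply_eq_ite, hy, ← Nat.card_eq_fintype_card]
        congr!
    _ = φ (toLp μ f x) := by
        simp only [ite_mul, zero_mul, Finset.sum_ite_eq', Finset.mem_univ, if_true]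
        exact inv_mul_cancel_left₀ hc _

/-- The character of `L^p(G, A)` given by a character of `A` and a character of the finite
group `G`. -/
noncomputable def fourierCharacter [CompleteSpace A] (φ : WeakDual.characterSpace ℂ A)
    (ψ : AddChar (Additive G) ℂ) : WeakDual.characterSpace ℂ (LpConv A p μ) :=
  ⟨(fourierCLM μ p φ ψ : StrongDual ℂ (LpConv A p μ)), by
    refine ⟨fun h0 => ?_, fourierCLM_mul μ p φ ψ⟩
    -- Test function for nonvanishing: its `ψ`-th coefficient is `φ(1) = 1`.
    let u : G → A := fun y => ψ (.ofMul y) • 1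
    have hu : MemLp u p μ :=
      MemLp.of_bound .of_discrete (∑ y, ‖u y‖) (.of_forall fun y =>
        Finset.single_le_sum (f := fun y => ‖u y‖) (fun _ _ => norm_nonneg _) (Finset.mem_univ y))
    let f : LpConv A p μ := hu.toLp u
    have hf : ⇑(toLp μ f) = u := eq_of_ae_eq μ hu.coeFn_toLp
    have h : fourierCLM μ p φ ψ f = 0 := DFunLike.congr_fun h0 f
    have hc : (Nat.card G : ℂ) ≠ 0 := by exact_mod_cast Nat.card_pos.ne'
    have hψ : ∀ y : G, ψ (.ofMul y⁻¹) * ψ (.ofMul y) = 1 := fun y => by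
      rw [← AddChar.map_add_eq_mul, ← ofMul_mul, inv_mul_cancel, ofMul_one,
        AddChar.map_zero_eq_one]
    rw [fourierCLM_apply, hf] at h
    simp only [u, map_smul, map_one, smul_eq_mul, mul_one, hψ, Finset.sum_const,
      Finset.card_univ, nsmul_eq_mul, ← Nat.card_eq_fintype_card, inv_mul_cancel₀ hc] at h
    exact one_ne_zero h⟩

theorem fourierCharacter_apply [CompleteSpace A] (φ : WeakDual.characterSpace ℂ A)
    (ψ : AddChar (Additive G) ℂ) (f : LpConv A p μ) :
    fourierCharacter μ p φ ψ f = fourierCLM μ p φ ψ f := rfl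

theorem isBSEConstant_apply [CompleteSpace A] {f : LpConv A p μ} {β : ℝ}
    (h : IsBSEConstant (gelfandFun f) β) (x : G) :
    IsBSEConstant (gelfandFun (toLp μ f x)) (β * Nat.card G) := by
  have hc : (0 : ℝ) < Nat.card G := by exact_mod_cast Nat.card_pos
  refine ⟨mul_pos h.1 hc, fun n α φ => ?_⟩
  -- The Fourier expansion of `∑ αₖ φₖ ∘ ev_x`: coefficients `αₖ ψ(x)` on the characters `φₖ ⊗ ψ`.
  let α' : Fin n × AddChar (Additive G) ℂ → ℂ := fun q => α q.1 * q.2 (.ofMul x)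
  let Φ : Fin n × AddChar (Additive G) ℂ → WeakDual.characterSpace ℂ (LpConv A p μ) :=
    fun q => fourierCharacter μ p (φ q.1) q.2
  have key : ∀ g : LpConv A p μ, ∑ q, α' q * Φ q g = ∑ k, α k * φ k (toLp μ g x) := by
    intro g
    rw [Fintype.sum_prod_type]
    simp only [α', Φ, fourierCharacter_apply, mul_assoc, ← Finset.mul_sum, sum_fourierCLM]
  have hle := h.norm_sum_le α' Φ
  simp only [gelfandFun_apply, key] at hle ⊢
  rw [mul_assoc]
  refine hle.trans (mul_le_mul_of_nonneg_left ?_ h.1.le)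
  refine norm_sum_smul_character_le _ _ (by positivity) fun g => ?_
  rw [key]
  refine (norm_sum_mul_character_le α φ _).trans ?_
  rw [mul_comm (Nat.card G : ℝ), mul_assoc]
  exact mul_le_mul_of_nonneg_left (norm_apply_le μ p g x) (norm_nonneg _)

theorem isBSENormAlgebra_of_finite [CompleteSpace A] (h : IsBSENormAlgebra A) :
    IsBSENormAlgebra (LpConv A p μ) := by
  obtain ⟨K, hK, h⟩ := h
  have hc : (0 : ℝ) < Nat.card G := by exact_mod_cast Nat.card_pos
  -- `K` bounds each `‖f(x)‖` by its BSE-norm; `|G|` is the cost of passing from `f(x)` to `f`.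
  refine ⟨K * Nat.card G, by positivity, fun f => ?_⟩
  rw [← div_le_iff₀' (by positivity)]
  refine le_bseNorm_gelfandFun fun β hβ => ?_
  rw [div_le_iff₀' (by positivity)]
  refine norm_le_of_forall_norm_apply_le μ p f (by have := hβ.1; positivity) fun x => ?_
  refine (h _).trans ?_
  rw [mul_assoc, mul_comm (Nat.card G : ℝ)]
  exact mul_le_mul_of_nonneg_left (bseNorm_le (isBSEConstant_apply μ p hβ x)) hK.le

end Finite

end LpConv

theorem theorem4p2
    {A : Type*} [NormedCommRing A] [NormedAlgebra ℂ A] [CompleteSpace A]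
    [TopologicalSpace.SeparableSpace A] (hA : IsGelfandSemisimple A)
    {G : Type*} [CommGroup G] [TopologicalSpace G] [IsTopologicalGroup G] [CompactSpace G]
    [T2Space G] [MeasurableSpace G] [BorelSpace G]
    (μ : Measure G) [μ.IsHaarMeasure] [IsProbabilityMeasure μ]
    (p : ℝ≥0∞) [Fact (1 ≤ p)] [Fact (p ≠ ∞)] :
    (IsBSENormAlgebra (LpConv A p μ) → IsBSENormAlgebra A) ∧
      (Finite G → IsBSENormAlgebra A → IsBSENormAlgebra (LpConv A p μ)) := by
  refine ⟨IsBSENormAlgebra.of_isometric (LpConv.constCLM μ p) (LpConv.constFun_mul μ p)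
    (LpConv.norm_constFun μ p), fun _ h => ?_⟩
  have := Fintype.ofFinite G
  exact LpConv.isBSENormAlgebra_of_finite μ p h
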